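/- Let $(X,d)$ and $(Y_n,\delta_n)$, $n\in\mathbb N$, be nonempty separable complete metric spaces, let $p,q\in[1,\infty)$ and $C>0$. For metric spaces $(X_n,d_n)$, $E((X_n)_{n\in\mathbb N};p)$ denotes the equivalence relation on $\prod_n X_n$ under which $x,y$ are equivalent iff $\sum_n d_n(x(n),y(n))^p<\infty$. Fix any sequence $F_0\subseteq F_1\subseteq\cdots$ of nonempty finite subsets of $X$ with $\bigcup_n F_n$ dense in $X$ and let $F(X;p)=E((F_n)_{n\in\mathbb N};p)$, each $F_n$ carrying the metric of $X$. For equivalence relations $E,E'$ on topological spaces $P,P'$, write $E\le_B E'$ if there is a Borel map $\theta:P\to P'$ such that $x\mathrel{E}y\iff\theta(x)\mathrel{E'}\theta(y)$ for all $x,y\in P$; products carry the product topology. For $y^*\in\prod_n Y_n$, $\ell_q((Y_n)_{n\in\mathbb N},y^*)$ is the set of $y\in\prod_n Y_n$ with $\sum_n\delta_n(y(n),y^*(n))^q<\infty$, with the metric $\delta_q(x,y)=\left(\sum_n\delta_n(x(n),y(n))^q\right)^{1/q}$. Suppose that (i) $X$ satisfies link($C$): for every $\varepsilon>0$ there is $N\ge1$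 such that for all $u,v\in X$ with $d(u,v)<C$ there are $r_0,\dots,r_N\in X$ with $r_0=u$, $r_N=v$ and $d(r_{i-1},r_i)<\varepsilon$ for $i=1,\dots,N$; and (ii) $F(X;p)\le_B E((Y_n)_{n\in\mathbb N};q)$. Then, for every $y^*\in\prod_n Y_n$, $X$ can $C$-finitely Hölder$(p/q)$ embed into $\ell_q((Y_n)_{n\in\mathbb N},y^*)$. That is, there are $A,D>0$ such that for every finite $F\subseteq X$ there is a map $T_F:F\to\ell_q((Y_n)_{n\in\mathbb N},y^*)$ such that for all $u,v\in F$: (1) if $d(u,v)\ge C$, then $\delta_q(T_F(u),T_F(v))\ge D$; (2) if $d(u,v)<C$, then $A^{-1}d(u,v)^{p/q}\le\delta_q(T_F(u),T_F(v))\le A\,d(u,v)^{p/q}$. -/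

import Mathlib

/-- `E` (a relation on `α`) is Borel reducible to `F` (a relation on `β`): there is a map
`θ : α → β`, measurable for the Borel σ-algebras, with `E x y ↔ F (θ x) (θ y)`. -/
def BorelReducible {α β : Type*} [TopologicalSpace α] [TopologicalSpace β]
    (E : α → α → Prop) (F : β → β → Prop) : Prop :=
  ∃ θ : α → β, @Measurable α β (borel α) (borel β) θ ∧ ∀ x y, E x y ↔ F (θ x) (θ y)

/-- The `ℓ_p`-like equivalence relation `E((X_n); p)` on `∏ X_n`:
`∑ d_n(x(n), y(n))^p < ∞`. -/
def EllRel (X : ℕ → Type*) [∀ n, PseudoMetricSpace (X n)] (p : ℝ) (x y : ∀ n, X n) : Prop :=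
  Summable fun n => dist (x n) (y n) ^ p

/-- An increasing sequence of nonempty finite subsets of `X` with dense union.
For such a sequence `F(X; p)` is the relation `E((F_n); p)` on `∏ F_n`. -/
structure IsFiniteExhaustion {X : Type*} [MetricSpace X] (F : ℕ → Finset X) : Prop where
  nonempty : ∀ n, (F n).Nonempty
  mono : Monotone F
  dense : Dense (⋃ n, (F n : Set X))

/-- The relation `F(X; p)`, computed from the sequence `F` of finite subsets of `X`, each with
the metric of `X`. -/
def FRel {X : Type*} [MetricSpace X] (F : ℕ → Finset X) (p : ℝ) (x y : ∀ n, {u // u ∈ F n}) :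
    Prop :=
  EllRel (fun n => {u // u ∈ F n}) p x y

/-- The chain condition link(`C`). -/
def Link (X : Type*) [MetricSpace X] (C : ℝ) : Prop :=
  ∀ ε : ℝ, 0 < ε → ∃ N : ℕ, 1 ≤ N ∧ ∀ u v : X, dist u v < C →
    ∃ r : ℕ → X, r 0 = u ∧ r N = v ∧ ∀ i < N, dist (r i) (r (i + 1)) < ε

/-- The underlying set of `ℓ_q((Y_n), y*)`. -/
def EllSpace (Y : ℕ → Type*) [∀ n, PseudoMetricSpace (Y n)] (q : ℝ) (ystar : ∀ n, Y n) : Type _ :=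
  {y : ∀ n, Y n // Summable fun n => dist (y n) (ystar n) ^ q}

namespace EllSpace

theorem triangle_aux {Y : ℕ → Type*} [∀ n, PseudoMetricSpace (Y n)] {q : ℝ} (hq : 1 ≤ q)
    {x y z : ∀ n, Y n} (hxy : Summable fun n => dist (x n) (y n) ^ q)
    (hyz : Summable fun n => dist (y n) (z n) ^ q) :
    (Summable fun n => dist (x n) (z n) ^ q) ∧
      (∑' n, dist (x n) (z n) ^ q) ^ (1 / q) ≤
        (∑' n, dist (x n) (y n) ^ q) ^ (1 / q) + (∑' n, dist (y n) (z n) ^ q) ^ (1 / q) := by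
  have h := Real.Lp_add_le_tsum_of_nonneg hq (fun n => dist_nonneg (x := x n) (y := y n))
    (fun n => dist_nonneg (x := y n) (y := z n)) hxy hyz
  have hle : ∀ n, dist (x n) (z n) ^ q ≤ (dist (x n) (y n) + dist (y n) (z n)) ^ q := fun n =>
    Real.rpow_le_rpow dist_nonneg (dist_triangle _ _ _) (by linarith)
  have hs : Summable fun n => dist (x n) (z n) ^ q :=
    Summable.of_nonneg_of_le (fun n => by positivity) hle h.1
  refine ⟨hs, le_trans ?_ h.2⟩
  exact Real.rpow_le_rpow (tsum_nonneg fun n => by positivity) (hs.tsum_le_tsum hle h.1)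
    (by positivity)

variable {Y : ℕ → Type*} [∀ n, PseudoMetricSpace (Y n)] {q : ℝ} {ystar : ∀ n, Y n}

theorem summable_dist (hq : 1 ≤ q) (x y : EllSpace Y q ystar) :
    Summable fun n => dist (x.1 n) (y.1 n) ^ q :=
  (triangle_aux hq x.2 (by simpa only [dist_comm] using y.2)).1

/-- The pseudo-metric `δ_q(x, y) = (∑ δ_n(x(n), y(n))^q)^(1/q)` of `ℓ_q((Y_n), y*)`. -/
noncomputable instance instPseudoMetricSpace [hq : Fact (1 ≤ q)] : PseudoMetricSpace (EllSpace Y q ystar) where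
  dist x y := (∑' n, dist (x.1 n) (y.1 n) ^ q) ^ (1 / q)
  dist_self x := by
    have h0 : q ≠ 0 := (zero_lt_one.trans_le hq.out).ne'
    simp [Real.zero_rpow h0, Real.zero_rpow (inv_ne_zero h0)]
  dist_comm x y := by simp only [dist_comm]
  dist_triangle x y z :=
    (triangle_aux hq.out (summable_dist hq.out x y) (summable_dist hq.out y z)).2

end EllSpace

/-- `X` can `C`-finitely Hölder(`α`) embed into `X'`; the constants `A`, `D` do not depend on the
finite subset `F`. -/
def FinitelyHolderEmbeds (X X' : Type*) [PseudoMetricSpace X] [PseudoMetricSpace X']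
    (C α : ℝ) : Prop :=
  ∃ A D : ℝ, 0 < A ∧ 0 < D ∧ ∀ F : Finset X, ∃ T : {u // u ∈ F} → X',
    ∀ u v : {u // u ∈ F},
      (C ≤ dist u v → D ≤ dist (T u) (T v)) ∧
      (dist u v < C →
        A⁻¹ * dist u v ^ α ≤ dist (T u) (T v) ∧ dist (T u) (T v) ≤ A * dist u v ^ α)

/-! The proof has a Baire category half and a counting half.

A Borel reduction `θ` is continuous on a comeagre set, and finite changes of its argument alter its
value only by a `q`-summable amount. Starting from a generic point `z`, one frees a sparse set of
coordinates `c j` and freezes the others at `z`. Up to geometric errors, the values of `θ` then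
split into consecutive blocks, the `j`-th depending on the coordinate `c j` alone
(`exists_blockwise_approximation`). Each block is a finitely supported element of `ℓ_q`, so it gives
a map `T j`, and these maps reduce the `p`-sum to the `q`-sum coordinate by coordinate
(`BorelReducible.exists_coordinatewiseReduces`).

Such a family must distort `d ^ p` into `δ ^ q` boundedly for large `j`: otherwise, repeating ever
worse pairs the right number of times makes one series converge and the other diverge. This gives an
upper bound at small distances, which link(`C`) extends to all distances below `C`, and a lower
bound at all distances, truncated at 1. For a finite set, a single large `j` serves all pairs after
approximation by points of the dense union. -/

open Filter Topology

/-! ### Hölder bounds from a coordinatewise reduction. -/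

section Metric

variable {X E : Type*} [MetricSpace X] [PseudoMetricSpace E] {p q C : ℝ}
  {G : ℕ → Finset X} {T : ℕ → X → E}

/-- The maps `T j` jointly reduce `∑ d(x_j, y_j)^p < ∞` on `∏ G j` to
`∑ d(T_j x_j, T_j y_j)^q < ∞`. -/
def CoordinatewiseReduces (G : ℕ → Finset X) (T : ℕ → X → E) (p q : ℝ) : Prop :=
  ∀ x y : ℕ → X, (∀ j, x j ∈ G j) → (∀ j, y j ∈ G j) →
    ((Summable fun j => dist (x j) (y j) ^ p) ↔ Summable fun j => dist (T j (x j)) (T j (y j)) ^ q)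

/-- Frequently satisfied properties `Q m` can be realised simultaneously at pairwise distinct
places, each `Q m` at `r m ≥ 1` of them. -/
theorem exists_injective_sigma_of_frequently {Q : ℕ → ℕ → Prop} (hQ : ∀ m, ∃ᶠ j in atTop, Q m j)
    {r : ℕ → ℕ} (hr : ∀ m, 0 < r m) :
    ∃ f : (Σ m, Fin (r m)) → ℕ, Function.Injective f ∧ ∀ a, Q a.1 (f a) := by
  have : Infinite (Σ m, Fin (r m)) :=
    Infinite.of_injective (fun m => ⟨m, ⟨0, hr m⟩⟩) fun a b h => congrArg Sigma.fst h
  obtain ⟨e⟩ : Nonempty ((Σ m, Fin (r m)) ≃ ℕ) := by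
    rw [← Cardinal.eq]; simp
  obtain ⟨f, hf, hfQ⟩ := extraction_forall_of_frequently (fun n => hQ (e.symm n).1)
  exact ⟨f ∘ e, hf.injective.comp e.injective, fun a => by simpa using hfQ (e a)⟩

theorem eventually_mem_of_mem_iUnion (hG : IsFiniteExhaustion G) {u : X}
    (hu : u ∈ ⋃ n, (G n : Set X)) : ∀ᶠ j in atTop, u ∈ G j := by
  obtain ⟨n, hn⟩ := Set.mem_iUnion.1 hu
  exact eventually_atTop.2 ⟨n, fun j hj => hG.mono hj hn⟩

/-- If the pair `(u m, v m)` is used at `r m` places `f (m, i)`, the reduction compares the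
resulting sums. -/
theorem CoordinatewiseReduces.summable_sigma_iff (hT : CoordinatewiseReduces G T p q)
    (hG : IsFiniteExhaustion G) (hp : 0 < p) (hq : 0 < q) {u v : ℕ → X} {r : ℕ → ℕ}
    {f : (Σ m, Fin (r m)) → ℕ} (hf : Function.Injective f)
    (hu : ∀ a, u a.1 ∈ G (f a)) (hv : ∀ a, v a.1 ∈ G (f a)) :
    (Summable fun m => r m * dist (u m) (v m) ^ p) ↔
      Summable fun a : Σ m, Fin (r m) => dist (T (f a) (u a.1)) (T (f a) (v a.1)) ^ q := by
  classical
  choose g hg using hG.nonempty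
  let x : (ℕ → X) → ℕ → X := fun u => Function.extend f (fun a => u a.1) g
  have hxf : ∀ u a, x u (f a) = u a.1 := fun u a => hf.extend_apply _ _ _
  have hxn : ∀ u j, j ∉ Set.range f → x u j = g j := fun u j hj =>
    Function.extend_apply' _ _ _ (by simpa using hj)
  have hx : ∀ u : ℕ → X, (∀ a, u a.1 ∈ G (f a)) → ∀ j, x u j ∈ G j := by
    intro u hu j
    by_cases hj : j ∈ Set.range f
    · obtain ⟨a, rfl⟩ := hj
      rw [hxf]; exact hu a
    · rw [hxn u j hj]; exact hg j
  have key := hT (x u) (x v) (hx u hu) (hx v hv)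
  rw [← hf.summable_iff, ← hf.summable_iff] at key
  · simp only [Function.comp_def, hxf] at key
    rw [← key, summable_sigma_of_nonneg (fun _ => by positivity)]
    simpa using fun _ _ => Summable.of_finite
  all_goals
    intro j hj
    rw [hxn u j hj, hxn v j hj, dist_self, Real.zero_rpow (by positivity)]

/-- If no constants work, choose pairs at distance below `2⁻ᵐ` that are stretched by more than `2ᵐ`
at infinitely many places. Repeating the `m`-th pair suitably often gives a `p`-sum of order `2⁻ᵐ`
but a `q`-sum of at least 1. -/
theorem exists_forall_eventually_dist_le (hT : CoordinatewiseReduces G T p q)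
    (hG : IsFiniteExhaustion G) (hp : 1 ≤ p) (hq : 1 ≤ q) :
    ∃ B η : ℝ, 0 < B ∧ 0 < η ∧ ∀ u ∈ ⋃ n, (G n : Set X), ∀ v ∈ ⋃ n, (G n : Set X), dist u v < η →
      ∀ᶠ j in atTop, dist (T j u) (T j v) ≤ B * dist u v ^ (p / q) := by
  by_contra! hcon
  have h1 : ∀ m : ℕ, ∃ u v, (u ∈ ⋃ n, (G n : Set X)) ∧ (v ∈ ⋃ n, (G n : Set X)) ∧
      dist u v < (1 / 2) ^ m ∧
      ∃ᶠ j in atTop, 2 ^ m * dist u v ^ (p / q) < dist (T j u) (T j v) := by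
    intro m
    obtain ⟨u, hu, v, hv, huv, h⟩ := hcon (2 ^ m) ((1 / 2) ^ m) (by positivity) (by positivity)
    exact ⟨u, v, hu, hv, huv, by simpa using h⟩
  choose u v hu hv huv hfr using h1
  have hne : ∀ m, 0 < dist (u m) (v m) := by
    intro m
    obtain ⟨j, hj⟩ := (hfr m).exists
    refine lt_of_le_of_ne dist_nonneg fun h0 => ?_
    rw [← h0, Real.zero_rpow (by positivity), dist_eq_zero.1 h0.symm] at hj
    simp at hj
  set d : ℕ → ℝ := fun m => dist (u m) (v m) ^ p with hd
  have hd0 : ∀ m, 0 < d m := fun m => Real.rpow_pos_of_pos (hne m) _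
  have hd1 : ∀ m, d m ≤ (1 / 2) ^ m := fun m => by
    refine le_trans ?_ (huv m).le
    exact Real.rpow_le_self_of_le_one (hne m).le
      ((huv m).le.trans (pow_le_one₀ (by norm_num) (by norm_num))) hp
  -- Since `d m ≤ 2⁻ᵐ`, rounding up at most doubles the contribution: `r m * d m` lies between `2⁻ᵐ`
  -- and `2 * 2⁻ᵐ`.
  let r : ℕ → ℕ := fun m => ⌈(1 / 2) ^ m / d m⌉₊
  have hr : ∀ m, 0 < r m := fun m => Nat.ceil_pos.2 (div_pos (by positivity) (hd0 m))
  have hrl : ∀ m, (1 / 2) ^ m ≤ r m * d m := fun m =>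
    (div_le_iff₀ (hd0 m)).1 (Nat.le_ceil _)
  have hru : ∀ m, r m * d m ≤ 2 * (1 / 2) ^ m := fun m => by
    have := (Nat.ceil_lt_add_one (a := (1 / 2) ^ m / d m) (by have := hd0 m; positivity)).le
    have := mul_le_mul_of_nonneg_right this (hd0 m).le
    rw [add_mul, div_mul_cancel₀ _ (hd0 m).ne'] at this
    have := hd1 m
    simp only [r]; linarith
  obtain ⟨f, hf, hfQ⟩ := exists_injective_sigma_of_frequently
    (fun m => (hfr m).and_eventually ((eventually_mem_of_mem_iUnion hG (hu m)).and
      (eventually_mem_of_mem_iUnion hG (hv m)))) hr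
  have hiff := hT.summable_sigma_iff hG (by linarith) (by linarith) hf (fun a => (hfQ a).2.1)
    (fun a => (hfQ a).2.2)
  have hs := hiff.1 (Summable.of_nonneg_of_le (fun m => by positivity) hru
    ((summable_geometric_of_lt_one (by norm_num) (by norm_num)).mul_left 2))
  have hs2 := hs.of_nonneg_of_le (g := fun a : Σ m, Fin (r m) => 2 ^ a.1 * d a.1)
    (fun a => by have := hd0 a.1; positivity) fun a => by
      have h2 := Real.rpow_le_rpow (by positivity) (hfQ a).1.le (by linarith : 0 ≤ q)
      refine le_trans ?_ h2
      rw [Real.mul_rpow (by positivity) (by positivity), ← Real.rpow_mul dist_nonneg,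
        div_mul_cancel₀ _ (by linarith : q ≠ 0)]
      refine mul_le_mul_of_nonneg_right ?_ (hd0 a.1).le
      exact Real.self_le_rpow_of_one_le (one_le_pow₀ (by norm_num)) hq
  rw [summable_sigma_of_nonneg (fun a => by have := hd0 a.1; positivity)] at hs2
  have h3 := hs2.2.tendsto_atTop_zero.eventually_lt_const one_pos
  obtain ⟨m, hm⟩ := h3.exists
  simp only [tsum_fintype, Finset.sum_const, Finset.card_univ, Fintype.card_fin, nsmul_eq_mul]
    at hm
  have h4 : (2 : ℝ) ^ m * (1 / 2) ^ m = 1 := by rw [← mul_pow]; norm_num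
  nlinarith [hrl m, pow_pos (two_pos (α := ℝ)) m]

/-- The dual repetition argument: the `m`-th pair now contributes at least 1 to the `p`-sum and at
most `2 * 2⁻ᵐ` to the `q`-sum. Truncating the distance at 1 keeps `r m * d m ≤ 2` after rounding up,
however far apart the points are. -/
theorem exists_forall_eventually_le_dist (hT : CoordinatewiseReduces G T p q)
    (hG : IsFiniteExhaustion G) (hp : 1 ≤ p) (hq : 1 ≤ q) :
    ∃ a : ℝ, 0 < a ∧ ∀ u ∈ ⋃ n, (G n : Set X), ∀ v ∈ ⋃ n, (G n : Set X),
      ∀ᶠ j in atTop, a * min (dist u v) 1 ^ (p / q) ≤ dist (T j u) (T j v) := by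
  by_contra! hcon
  have h1 : ∀ m : ℕ, ∃ u v, (u ∈ ⋃ n, (G n : Set X)) ∧ (v ∈ ⋃ n, (G n : Set X)) ∧
      ∃ᶠ j in atTop, dist (T j u) (T j v) < (1 / 2) ^ m * min (dist u v) 1 ^ (p / q) := by
    intro m
    obtain ⟨u, hu, v, hv, h⟩ := hcon ((1 / 2) ^ m) (by positivity)
    exact ⟨u, v, hu, hv, by simpa using h⟩
  choose u v hu hv hfr using h1
  have hne : ∀ m, 0 < dist (u m) (v m) := by
    intro m
    obtain ⟨j, hj⟩ := (hfr m).exists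
    refine lt_of_le_of_ne dist_nonneg fun h0 => ?_
    rw [← h0, min_eq_left zero_le_one, Real.zero_rpow (by positivity), mul_zero] at hj
    exact absurd hj (not_lt.2 dist_nonneg)
  have hmin : ∀ m, 0 < min (dist (u m) (v m)) 1 := fun m => lt_min (hne m) one_pos
  set d : ℕ → ℝ := fun m => min (dist (u m) (v m)) 1 ^ p with hd
  have hd0 : ∀ m, 0 < d m := fun m => Real.rpow_pos_of_pos (hmin m) _
  have hd1 : ∀ m, d m ≤ 1 := fun m =>
    Real.rpow_le_one (hmin m).le (min_le_right _ _) (by linarith)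
  let r : ℕ → ℕ := fun m => ⌈1 / d m⌉₊
  have hr : ∀ m, 0 < r m := fun m => Nat.ceil_pos.2 (div_pos (by positivity) (hd0 m))
  have hrl : ∀ m, 1 ≤ r m * d m := fun m => (div_le_iff₀ (hd0 m)).1 (Nat.le_ceil _)
  have hru : ∀ m, r m * d m ≤ 2 := fun m => by
    have := (Nat.ceil_lt_add_one (a := 1 / d m) (by have := hd0 m; positivity)).le
    have := mul_le_mul_of_nonneg_right this (hd0 m).le
    rw [add_mul, div_mul_cancel₀ _ (hd0 m).ne'] at this
    have := hd1 m
    simp only [r]; linarith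
  obtain ⟨f, hf, hfQ⟩ := exists_injective_sigma_of_frequently
    (fun m => (hfr m).and_eventually ((eventually_mem_of_mem_iUnion hG (hu m)).and
      (eventually_mem_of_mem_iUnion hG (hv m)))) hr
  have hiff := hT.summable_sigma_iff hG (by linarith) (by linarith) hf (fun a => (hfQ a).2.1)
    (fun a => (hfQ a).2.2)
  have hs2 : Summable fun a : Σ m, Fin (r m) => (1 / 2) ^ a.1 * d a.1 := by
    rw [summable_sigma_of_nonneg (fun a => by have := hd0 a.1; positivity)]
    refine ⟨fun m => Summable.of_finite, ?_⟩
    simp only [tsum_fintype, Finset.sum_const, Finset.card_univ, Fintype.card_fin, nsmul_eq_mul]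
    refine Summable.of_nonneg_of_le (fun m => by have := hd0 m; positivity) (fun m => ?_)
      ((summable_geometric_of_lt_one (by norm_num : (0 : ℝ) ≤ 1 / 2) (by norm_num)).mul_left 2)
    nlinarith [hru m, pow_pos (by norm_num : (0 : ℝ) < 1 / 2) m]
  have hs := hs2.of_nonneg_of_le
    (g := fun a : Σ m, Fin (r m) => dist (T (f a) (u a.1)) (T (f a) (v a.1)) ^ q)
    (fun a => by positivity) fun a => by
      have h2 := Real.rpow_le_rpow dist_nonneg (hfQ a).1.le (by linarith : 0 ≤ q)
      refine h2.trans ?_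
      rw [Real.mul_rpow (by positivity) (by have := hmin a.1; positivity),
        ← Real.rpow_mul (hmin _).le, div_mul_cancel₀ _ (by linarith : q ≠ 0)]
      refine mul_le_mul_of_nonneg_right ?_ (hd0 a.1).le
      exact Real.rpow_le_self_of_le_one (by positivity)
        (pow_le_one₀ (by norm_num) (by norm_num)) hq
  have h3 := (hiff.2 hs).tendsto_atTop_zero.eventually_lt_const one_pos
  obtain ⟨m, hm⟩ := h3.exists
  have h5 : d m ≤ dist (u m) (v m) ^ p :=
    Real.rpow_le_rpow (hmin m).le (min_le_left _ _) (by linarith)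
  nlinarith [hrl m, (Nat.cast_nonneg (r m) : (0 : ℝ) ≤ r m)]

/-- Chains witnessing `Link X C` can be taken inside a dense set, up to their end points. -/
theorem Link.exists_chain_mem_dense (hlink : Link X C) {S : Set X} (hS : Dense S) {η : ℝ}
    (hη : 0 < η) : ∃ N : ℕ, ∀ u ∈ S, ∀ v ∈ S, dist u v < C →
      ∃ r : ℕ → X, r 0 = u ∧ r N = v ∧ (∀ i, r i ∈ S) ∧ ∀ i < N, dist (r i) (r (i + 1)) < η := by
  obtain ⟨N, -, h⟩ := hlink (η / 3) (by positivity)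
  refine ⟨N, fun u hu v hv huv => ?_⟩
  obtain ⟨r, h0, hN, hr⟩ := h u v huv
  -- Points already in `S` are not moved, so the end points of the chain survive.
  have : ∀ i, ∃ s ∈ S, dist (r i) s < η / 3 ∧ (r i ∈ S → s = r i) := fun i => by
    by_cases hi : r i ∈ S
    · exact ⟨r i, hi, by simpa using hη, fun _ => rfl⟩
    · obtain ⟨s, hs, hd⟩ := hS.exists_dist_lt (r i) (by positivity : 0 < η / 3)
      exact ⟨s, hs, hd, fun h => absurd h hi⟩
  choose s hs hd he using this
  refine ⟨s, ?_, ?_, hs, fun i hi => ?_⟩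
  · rw [he 0 (by rwa [h0]), h0]
  · rw [he N (by rwa [hN]), hN]
  · have h1 := dist_triangle4 (s i) (r i) (r (i + 1)) (s (i + 1))
    have h2 := hr i hi
    have h3 := hd i
    rw [dist_comm] at h3
    linarith [hd (i + 1)]

/-- At distance at least `η`, a chain of `N` steps shorter than `η` has every step at most `dist u
v`, so the triangle inequality costs only the factor `N`, uniform in the pair. -/
theorem exists_forall_eventually_dist_le_of_link (hT : CoordinatewiseReduces G T p q)
    (hG : IsFiniteExhaustion G) (hp : 1 ≤ p) (hq : 1 ≤ q) (hlink : Link X C) :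
    ∃ B : ℝ, 0 < B ∧ ∀ u ∈ ⋃ n, (G n : Set X), ∀ v ∈ ⋃ n, (G n : Set X), dist u v < C →
      ∀ᶠ j in atTop, dist (T j u) (T j v) ≤ B * dist u v ^ (p / q) := by
  obtain ⟨B, η, hB, hη, h⟩ := exists_forall_eventually_dist_le hT hG hp hq
  obtain ⟨N, hN⟩ := hlink.exists_chain_mem_dense hG.dense hη
  have hα : 0 ≤ p / q := by positivity
  refine ⟨max B (N * B), lt_max_of_lt_left hB, fun u hu v hv huv => ?_⟩
  rcases lt_or_ge (dist u v) η with hlt | hge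
  · filter_upwards [h u hu v hv hlt] with j hj
    exact hj.trans (mul_le_mul_of_nonneg_right (le_max_left _ _) (by positivity))
  · obtain ⟨r, rfl, rfl, hrS, hr⟩ := hN u hu v hv huv
    have hev : ∀ i ∈ Finset.range N, ∀ᶠ j in atTop,
        dist (T j (r i)) (T j (r (i + 1))) ≤ B * dist (r i) (r (i + 1)) ^ (p / q) :=
      fun i hi => h _ (hrS i) _ (hrS (i + 1)) (hr i (Finset.mem_range.1 hi))
    filter_upwards [(Finset.eventually_all _).2 hev] with j hj
    calc dist (T j (r 0)) (T j (r N))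
        ≤ ∑ i ∈ Finset.range N, dist (T j (r i)) (T j (r (i + 1))) :=
          dist_le_range_sum_dist (fun i => T j (r i)) N
      _ ≤ ∑ i ∈ Finset.range N, B * dist (r 0) (r N) ^ (p / q) := by
          refine Finset.sum_le_sum fun i hi => (hj i hi).trans ?_
          refine mul_le_mul_of_nonneg_left (Real.rpow_le_rpow dist_nonneg ?_ hα) hB.le
          exact (hr i (Finset.mem_range.1 hi)).le.trans hge
      _ = N * B * dist (r 0) (r N) ^ (p / q) := by simp [mul_assoc]
      _ ≤ _ := mul_le_mul_of_nonneg_right (le_max_right _ _) (by positivity)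

theorem CoordinatewiseReduces.finitelyHolderEmbeds (hT : CoordinatewiseReduces G T p q)
    (hG : IsFiniteExhaustion G) (hp : 1 ≤ p) (hq : 1 ≤ q) (hC : 0 < C) (hlink : Link X C) :
    FinitelyHolderEmbeds X E C (p / q) := by
  obtain ⟨B, hB, hupper⟩ := exists_forall_eventually_dist_le_of_link hT hG hp hq hlink
  obtain ⟨a, ha, hlower⟩ := exists_forall_eventually_le_dist hT hG hp hq
  have hα : 0 < p / q := by positivity
  set α := p / q
  -- Chosen so that `κ * d ≤ min (d / 2) 1` for `0 ≤ d < C`, which absorbs both the approximation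
  -- error and the truncation at 1.
  set κ : ℝ := min (1 / 2) (1 / C) with hκ
  have hκ0 : 0 < κ := lt_min (by norm_num) (by positivity)
  refine ⟨max (B * 2 ^ α) (a * κ ^ α)⁻¹, a * min (C / 2) 1 ^ α,
    lt_max_of_lt_left (by positivity), ?_, fun F => ?_⟩
  · have : 0 < min (C / 2) 1 := lt_min (by positivity) one_pos
    positivity
  have happ : ∀ u : X, ∃ s : ℕ → X, (∀ n, s n ∈ ⋃ n, (G n : Set X)) ∧ Tendsto s atTop (𝓝 u) :=
    fun u => mem_closure_iff_seq_limit.1 (hG.dense u)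
  choose s hsS hs using happ
  have hev : ∀ᶠ n in atTop, ∀ u v : {u // u ∈ F}, u ≠ v →
      dist u v / 2 < dist (s u n) (s v n) ∧ dist (s u n) (s v n) < 2 * dist u v ∧
        (dist u v < C → dist (s u n) (s v n) < C) := by
    refine eventually_all.2 fun u => eventually_all.2 fun v => ?_
    by_cases huv : u = v
    · exact Eventually.of_forall fun n h => absurd huv h
    have hpos : 0 < dist (u : X) v := dist_pos.2 fun h => huv (Subtype.ext h)
    have ht : Tendsto (fun n => dist (s u n) (s v n)) atTop (𝓝 (dist (u : X) v)) :=
      (hs u).dist (hs v)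
    have h3 : ∀ᶠ n in atTop, dist (u : X) v < C → dist (s u n) (s v n) < C := by
      by_cases h : dist (u : X) v < C
      · filter_upwards [ht.eventually_lt_const h] with n hn _ using hn
      · exact Eventually.of_forall fun n h' => absurd h' h
    filter_upwards [ht.eventually_const_lt (half_lt_self hpos),
      ht.eventually_lt_const (by linarith : dist (u : X) v < 2 * dist (u : X) v), h3]
      with n h1 h2 h3 _ using ⟨h1, h2, h3⟩
  obtain ⟨n, hn⟩ := hev.exists
  have hev2 : ∀ᶠ j in atTop, ∀ u v : {u // u ∈ F},
      a * min (dist (s u n) (s v n)) 1 ^ α ≤ dist (T j (s u n)) (T j (s v n)) ∧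
      (dist (s u n) (s v n) < C →
        dist (T j (s u n)) (T j (s v n)) ≤ B * dist (s u n) (s v n) ^ α) := by
    refine eventually_all.2 fun u => eventually_all.2 fun v => ?_
    refine (hlower _ (hsS u n) _ (hsS v n)).and ?_
    by_cases h : dist (s u n) (s v n) < C
    · filter_upwards [hupper _ (hsS u n) _ (hsS v n) h] with j hj _ using hj
    · exact Eventually.of_forall fun j h' => absurd h' h
  obtain ⟨j, hj⟩ := hev2.exists
  refine ⟨fun u => T j (s u n), fun u v => ?_⟩
  by_cases huv : u = v
  · subst huv
    simp only [dist_self, Real.zero_rpow hα.ne', mul_zero, le_refl, and_self, implies_true,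
      and_true]
    intro h; exact absurd h (not_le.2 hC)
  obtain ⟨h1, h2, h3⟩ := hn u v huv
  obtain ⟨hl, hu⟩ := hj u v
  have hd0 : 0 ≤ dist u v := dist_nonneg
  refine ⟨fun hCd => le_trans ?_ hl, fun hdC => ⟨le_trans ?_ hl, (hu (h3 hdC)).trans ?_⟩⟩
  · refine mul_le_mul_of_nonneg_left (Real.rpow_le_rpow ?_ ?_ hα.le) ha.le
    · exact le_min (by positivity) zero_le_one
    · exact min_le_min_right _ (by linarith)
  · have hA : (max (B * 2 ^ α) (a * κ ^ α)⁻¹)⁻¹ ≤ a * κ ^ α :=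
      inv_le_of_inv_le₀ (by positivity) (le_max_right _ _)
    calc _ ≤ a * κ ^ α * dist u v ^ α := mul_le_mul_of_nonneg_right hA (by positivity)
      _ = a * (κ * dist u v) ^ α := by rw [Real.mul_rpow hκ0.le hd0, mul_assoc]
      _ ≤ _ := by
        refine mul_le_mul_of_nonneg_left (Real.rpow_le_rpow (by positivity) ?_ hα.le) ha.le
        refine le_min ?_ ?_
        · have := mul_le_mul_of_nonneg_right (min_le_left (1 / 2) (1 / C)) hd0
          linarith
        · have := mul_le_mul_of_nonneg_right (min_le_right (1 / 2) (1 / C)) hd0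
          rw [one_div_mul_eq_div] at this
          exact this.trans ((div_le_one hC).2 hdC.le)
  · calc B * dist (s u n) (s v n) ^ α ≤ B * (2 * dist u v) ^ α :=
          mul_le_mul_of_nonneg_left (Real.rpow_le_rpow dist_nonneg h2.le hα.le) hB.le
      _ = B * 2 ^ α * dist u v ^ α := by rw [Real.mul_rpow two_pos.le hd0, mul_assoc]
      _ ≤ _ := mul_le_mul_of_nonneg_right (le_max_left _ _) (by positivity)

end Metric

/-! ### Borel sets and maps on a residual set. -/

section Baire

/-- Countably many Borel sets become relatively open on a suitable residual set. -/
theorem exists_residual_forall_eventually_mem {P ι : Type*} [TopologicalSpace P]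
    [MeasurableSpace P] [BorelSpace P] [Countable ι] {V : ι → Set P}
    (hV : ∀ i, MeasurableSet (V i)) :
    ∃ R ∈ residual P, ∀ i, ∀ x ∈ R, x ∈ V i → ∀ᶠ w in 𝓝[R] x, w ∈ V i := by
  choose U hUo hU using fun i => (hV i).residualEq_isOpen
  refine ⟨{x | ∀ i, x ∈ V i ↔ x ∈ U i}, ?_, fun i x hx hxV => ?_⟩
  -- Each Borel set agrees with an open set off a meagre set; `R` discards these countably many
  -- meagre sets.
  · exact eventually_countable_forall.2 fun i => (hU i).mem_iff
  · filter_upwards [self_mem_nhdsWithin,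
      mem_nhdsWithin_of_mem_nhds ((hUo i).mem_nhds ((hx i).1 hxV))] with w hw hwU
    exact (hw i).2 hwU

/-- A Borel map into a second countable space is continuous on a residual set. -/
theorem Measurable.exists_residual_continuousOn {P Z : Type*} [TopologicalSpace P]
    [MeasurableSpace P] [BorelSpace P] [TopologicalSpace Z] [SecondCountableTopology Z]
    [MeasurableSpace Z] [BorelSpace Z] {f : P → Z} (hf : Measurable f) :
    ∃ R ∈ residual P, ContinuousOn f R := by
  have hB := TopologicalSpace.isBasis_countableBasis Z
  have := (TopologicalSpace.countable_countableBasis Z).to_subtype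
  obtain ⟨R, hR, h⟩ := exists_residual_forall_eventually_mem
    (V := fun i : TopologicalSpace.countableBasis Z => f ⁻¹' i)
    fun i => hf (hB.isOpen i.2).measurableSet
  refine ⟨R, hR, fun x hx => ?_⟩
  refine (hB.nhds_hasBasis.tendsto_right_iff).2 fun s hs => ?_
  exact h ⟨s, hs.1⟩ x hx hs.2

end Baire

/-! ### Finite modifications of points in a product of discrete spaces. -/

section Overwrite

variable {A : ℕ → Type*}

/-- Replace the first `k` coordinates of `x` by the string `r`. -/
def overwrite (k : ℕ) (r : ∀ i : Fin k, A i) (x : ∀ n, A n) : ∀ n, A n :=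
  fun n => if h : n < k then r ⟨n, h⟩ else x n

theorem overwrite_of_lt {k : ℕ} {r : ∀ i : Fin k, A i} {x : ∀ n, A n} {n : ℕ} (h : n < k) :
    overwrite k r x n = r ⟨n, h⟩ := dif_pos h

theorem overwrite_of_le {k : ℕ} {r : ∀ i : Fin k, A i} {x : ∀ n, A n} {n : ℕ} (h : k ≤ n) :
    overwrite k r x n = x n := dif_neg (not_lt.2 h)

theorem overwrite_self (k : ℕ) (x : ∀ n, A n) : overwrite k (fun i => x i) x = x := by
  funext n
  simp [overwrite]

variable [∀ n, TopologicalSpace (A n)]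

theorem continuous_overwrite (k : ℕ) (r : ∀ i : Fin k, A i) : Continuous (overwrite k r) := by
  refine continuous_pi fun n => ?_
  by_cases h : n < k
  · simpa [overwrite, h] using continuous_const
  · simpa [overwrite, h] using continuous_apply n

variable [∀ n, DiscreteTopology (A n)]

/-- A cylinder is sent to a cylinder. Openness makes preimages of residual sets residual, so a
generic point stays generic under all finite modifications. -/
theorem isOpenMap_overwrite (k : ℕ) (r : ∀ i : Fin k, A i) : IsOpenMap (overwrite k r) := by
  rw [(PiNat.isTopologicalBasis_cylinders A).isOpenMap_iff]
  rintro _ ⟨x, n, rfl⟩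
  convert PiNat.isOpen_cylinder A (overwrite k r x) (max n k) using 1
  ext y
  simp only [Set.mem_image, PiNat.mem_cylinder_iff]
  constructor
  · rintro ⟨w, hw, rfl⟩ i hi
    rcases lt_or_ge i k with hik | hik
    · rw [overwrite_of_lt hik, overwrite_of_lt hik]
    · rw [overwrite_of_le hik, overwrite_of_le hik, hw i (by omega)]
  · intro hy
    refine ⟨overwrite n (fun i => x i) y, fun i hi => overwrite_of_lt hi, ?_⟩
    funext i
    rcases lt_or_ge i k with hik | hik
    · rw [hy i (by omega), overwrite_of_lt hik, overwrite_of_lt hik]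
    · rw [overwrite_of_le hik]
      rcases lt_or_ge i n with hin | hin
      · rw [overwrite_of_lt hin, hy i (by omega), overwrite_of_le hik]
      · rw [overwrite_of_le hin]

theorem eventually_forall_agree_of_mem_nhds {x : ∀ n, A n} {s : Set (∀ n, A n)} (hs : s ∈ 𝓝 x) :
    ∀ᶠ M in atTop, ∀ w : ∀ n, A n, (∀ i < M, w i = x i) → w ∈ s := by
  obtain ⟨_, ⟨y, n, rfl⟩, hx, hsub⟩ := (PiNat.isTopologicalBasis_cylinders A).mem_nhds_iff.1 hs
  filter_upwards [eventually_ge_atTop n] with M hM w hw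
  exact hsub fun i hi => (hw i (hi.trans_le hM)).trans (hx i hi)

end Overwrite

/-! ### Splitting a Borel reduction into blocks around a generic point. -/

section Localization

/-- The `q`-th power of the `ℓ_q`-distance of `x` and `y` over the finite index set `s`. -/
noncomputable def ellSum {Y : ℕ → Type*} [∀ n, PseudoMetricSpace (Y n)] (q : ℝ) (s : Finset ℕ)
    (x y : ∀ n, Y n) : ℝ :=
  ∑ n ∈ s, dist (x n) (y n) ^ q

variable {Y : ℕ → Type*} [∀ n, PseudoMetricSpace (Y n)] {q : ℝ}

theorem ellSum_nonneg (s : Finset ℕ) (x y : ∀ n, Y n) : 0 ≤ ellSum q s x y :=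
  Finset.sum_nonneg fun _ _ => by positivity

theorem ellSum_comm (s : Finset ℕ) (x y : ∀ n, Y n) : ellSum q s x y = ellSum q s y x := by
  simp only [ellSum, dist_comm]

theorem ellSum_mono {s t : Finset ℕ} (h : s ⊆ t) (x y : ∀ n, Y n) :
    ellSum q s x y ≤ ellSum q t x y :=
  Finset.sum_le_sum_of_subset_of_nonneg h fun _ _ _ => by positivity

/-- Each sum of two distances is at most twice the larger one. Working with `q`-th powers rather
than norms costs only a constant, harmless for summability. -/
theorem ellSum_triangle (hq : 0 ≤ q) (s : Finset ℕ) (x y z : ∀ n, Y n) :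
    ellSum q s x z ≤ 2 ^ q * (ellSum q s x y + ellSum q s y z) := by
  rw [ellSum, ellSum, ellSum, ← Finset.sum_add_distrib, Finset.mul_sum]
  refine Finset.sum_le_sum fun n _ => ?_
  have h : ∀ a b : ℝ, 0 ≤ a → a ≤ b → (a + b) ^ q ≤ 2 ^ q * (a ^ q + b ^ q) := fun a b ha hab => by
    have hb := ha.trans hab
    calc (a + b) ^ q ≤ (2 * b) ^ q := Real.rpow_le_rpow (by positivity) (by linarith) hq
      _ = 2 ^ q * b ^ q := Real.mul_rpow (by norm_num) hb
      _ ≤ _ := mul_le_mul_of_nonneg_left (le_add_of_nonneg_left (by positivity)) (by positivity)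
  refine (Real.rpow_le_rpow dist_nonneg (dist_triangle _ (y n) _) hq).trans ?_
  rcases le_total (dist (x n) (y n)) (dist (y n) (z n)) with hl | hl
  · exact h _ _ dist_nonneg hl
  · rw [add_comm, add_comm (dist (x n) (y n) ^ q)]
    exact h _ _ dist_nonneg hl

theorem eventually_forall_ellSum_Ico_le {x y : ∀ n, Y n} (h : EllRel Y q x y) {ε : ℝ}
    (hε : 0 < ε) : ∀ᶠ l in atTop, ∀ N, ellSum q (Finset.Ico l N) x y ≤ ε := by
  have ht := tendsto_sum_nat_add fun n => dist (x n) (y n) ^ q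
  filter_upwards [ht.eventually_le_const hε] with l hl N
  rw [ellSum, Finset.sum_Ico_eq_sum_range]
  refine le_trans ?_ hl
  refine (Finset.sum_congr rfl fun i _ => by rw [add_comm l i]).le.trans
    (((summable_nat_add_iff l).2 h).sum_le_tsum (Finset.range (N - l)) fun _ _ => by positivity)

variable {A : ℕ → Type*} {θ : (∀ n, A n) → ∀ n, Y n}

/-- The points `x` such that the images under `θ` of any two modifications of `x` below `k` are
close on all coordinates from `l` on. -/
def tailCloseSet (q : ℝ) (θ : (∀ n, A n) → ∀ n, Y n) (k l : ℕ) : Set (∀ n, A n) :=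
  {x | ∀ r r' : ∀ i : Fin k, A i, ∀ N,
    ellSum q (Finset.Ico l N) (θ (overwrite k r x)) (θ (overwrite k r' x)) ≤ (1 / 2) ^ k}

/-- Two modifications below `k` have equivalent images, hence small tails. The factors being finite,
only finitely many pairs of strings compete for `l`. -/
theorem eventually_mem_tailCloseSet [∀ n, Finite (A n)]
    (htail : ∀ x y, (∀ᶠ n in atTop, x n = y n) → EllRel Y q (θ x) (θ y)) (k : ℕ)
    (x : ∀ n, A n) : ∀ᶠ l in atTop, x ∈ tailCloseSet q θ k l := by
  refine eventually_all.2 fun r => eventually_all.2 fun r' => ?_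
  refine eventually_forall_ellSum_Ico_le (htail _ _ ?_) (by positivity)
  filter_upwards [eventually_ge_atTop k] with n hn
  rw [overwrite_of_le hn, overwrite_of_le hn]

variable [∀ n, Finite (A n)] [∀ n, TopologicalSpace (A n)] [MeasurableSpace (∀ n, A n)] [BorelSpace (∀ n, A n)]
  [∀ n, MeasurableSpace (Y n)] [∀ n, BorelSpace (Y n)] [∀ n, SecondCountableTopology (Y n)]

theorem measurableSet_tailCloseSet (hθ : ∀ n, Measurable fun x => θ x n) (k l : ℕ) :
    MeasurableSet (tailCloseSet q θ k l) := by
  simp only [tailCloseSet, Set.ofPred_forall]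
  refine MeasurableSet.iInter fun r => MeasurableSet.iInter fun r' => MeasurableSet.iInter fun N =>
    measurableSet_le ?_ measurable_const
  refine Finset.measurable_fun_sum _ fun n _ => Measurable.pow_const ?_ _
  exact ((hθ n).comp (continuous_overwrite k r).measurable).dist
    ((hθ n).comp (continuous_overwrite k r').measurable)

/-- A generic point `z`, together with bounds `l k` and `H k` controlling `θ` near the points that
agree with `z` on `[k, H k)`. -/
theorem exists_generic_point [∀ n, DiscreteTopology (A n)] [∀ n, Nonempty (A n)] (hq : 0 < q)
    (hθ : ∀ n, Measurable fun x => θ x n)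
    (htail : ∀ x y, (∀ᶠ n in atTop, x n = y n) → EllRel Y q (θ x) (θ y)) :
    ∃ (z : ∀ n, A n) (O : ℕ → Set (∀ n, A n)) (l H : ℕ → ℕ), ∀ k, k ≤ l k ∧ l k ≤ H k ∧
      (∀ w, (∀ n, k ≤ n → n < H k → w n = z n) → ∀ i ≤ k, w ∈ O i) ∧
      (∀ w ∈ ⋂ i, O i, (∀ n < H k, w n = z n) → w ∈ tailCloseSet q θ k (l k)) ∧
      (∀ w ∈ ⋂ i, O i, (∀ n, k ≤ n → n < H k → w n = z n) →
        ellSum q (Finset.range (l k)) (θ w) (θ (overwrite k (fun i => w i) z)) ≤ (1 / 2) ^ k) := by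
  choose R₁ hR₁ hcont using fun n => (hθ n).exists_residual_continuousOn
  obtain ⟨R₂, hR₂, hV⟩ := exists_residual_forall_eventually_mem
    (V := fun a : ℕ × ℕ => tailCloseSet q θ a.1 a.2)
    fun a => measurableSet_tailCloseSet hθ a.1 a.2
  obtain ⟨R, hRsub, hRG, hRd⟩ := mem_residual.1
    (inter_mem (countable_iInter_mem.2 hR₁) hR₂)
  obtain ⟨O, hO, rfl⟩ := hRG.eq_iInter_nat
  -- There are only countably many finite strings, so a generic `z` lies in the good set together
  -- with all its finite modifications.
  have hres : ∀ᶠ z in residual (∀ n, A n), ∀ k, ∀ r : ∀ i : Fin k, A i,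
      overwrite k r z ∈ ⋂ i, O i :=
    eventually_countable_forall.2 fun k => eventually_countable_forall.2 fun r =>
      (tendsto_residual_of_isOpenMap (continuous_overwrite k r) (isOpenMap_overwrite k r))
        (residual_of_dense_Gδ hRG hRd)
  obtain ⟨z, hz⟩ := (dense_of_mem_residual hres).nonempty
  have hzR : z ∈ ⋂ i, O i := overwrite_self 0 z ▸ hz 0 fun i => z i
  have hagree : ∀ (k M : ℕ) (w : ∀ n, A n), (∀ n, k ≤ n → n < M → w n = z n) →
      ∀ n < M, w n = overwrite k (fun i => w i) z n := by
    intro k M w hw n hn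
    rcases lt_or_ge n k with h | h
    · rw [overwrite_of_lt h]
    · rw [overwrite_of_le h, hw n h hn]
  have hmain : ∀ k, ∃ l H, k ≤ l ∧ l ≤ H ∧
      (∀ w, (∀ n, k ≤ n → n < H → w n = z n) → ∀ i ≤ k, w ∈ O i) ∧
      (∀ w ∈ ⋂ i, O i, (∀ n < H, w n = z n) → w ∈ tailCloseSet q θ k l) ∧
      (∀ w ∈ ⋂ i, O i, (∀ n, k ≤ n → n < H → w n = z n) →
        ellSum q (Finset.range l) (θ w) (θ (overwrite k (fun i => w i) z)) ≤ (1 / 2) ^ k) := by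
    intro k
    obtain ⟨l, hzl, hkl⟩ := ((eventually_mem_tailCloseSet htail k z).and
      (eventually_ge_atTop k)).exists
    -- The bound is uniform over the finitely many prefixes, so agreement with `z` on `[k, M)` alone
    -- forces membership in `O i` for `i ≤ k`. Points with infinitely many such windows lie in the
    -- whole intersection.
    have e1 : ∀ᶠ M in atTop, ∀ r : ∀ i : Fin k, A i, ∀ i : Fin (k + 1), ∀ w : ∀ n, A n,
        (∀ n < M, w n = overwrite k r z n) → w ∈ O i :=
      eventually_all.2 fun r => eventually_all.2 fun i => eventually_forall_agree_of_mem_nhds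
        ((hO i).mem_nhds (Set.mem_iInter.1 (hz k r) i))
    have e2 : ∀ᶠ M in atTop, ∀ w : ∀ n, A n, (∀ n < M, w n = z n) →
        w ∈ ⋂ i, O i → w ∈ tailCloseSet q θ k l := by
      refine eventually_forall_agree_of_mem_nhds (s := {w | w ∈ _ → w ∈ _}) ?_
      refine mem_nhdsWithin_iff_eventually.1 ?_
      exact nhdsWithin_mono _ (fun w hw => (hRsub hw).2) (hV (k, l) z (hRsub hzR).2 hzl)
    have e3 : ∀ᶠ M in atTop, ∀ r : ∀ i : Fin k, A i, ∀ w : ∀ n, A n,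
        (∀ n < M, w n = overwrite k r z n) → w ∈ ⋂ i, O i →
        ellSum q (Finset.range l) (θ w) (θ (overwrite k r z)) ≤ (1 / 2) ^ k := by
      refine eventually_all.2 fun r => ?_
      refine eventually_forall_agree_of_mem_nhds (s := {w | w ∈ _ → _ ≤ _}) ?_
      refine mem_nhdsWithin_iff_eventually.1 ?_
      have ht : Tendsto (fun w => ellSum q (Finset.range l) (θ w) (θ (overwrite k r z)))
          (𝓝[⋂ i, O i] (overwrite k r z)) (𝓝 (∑ n ∈ Finset.range l, 0)) := by
        refine tendsto_finsetSum _ fun n _ => ?_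
        have h1 : Tendsto (fun w => θ w n) (𝓝[⋂ i, O i] (overwrite k r z))
            (𝓝 (θ (overwrite k r z) n)) :=
          ((hcont n).mono fun w hw => Set.mem_iInter.1 (hRsub hw).1 n) _ (hz k r)
        have h2 := (h1.dist (tendsto_const_nhds (x := θ (overwrite k r z) n))).rpow_const (p := q) (Or.inr hq.le)
        rwa [dist_self, Real.zero_rpow hq.ne'] at h2
      rw [Finset.sum_const_zero] at ht
      exact ht.eventually_le_const (by positivity)
    obtain ⟨M, ⟨⟨h1, h2⟩, h3⟩, hlM⟩ :=
      (((e1.and e2).and e3).and (eventually_ge_atTop l)).exists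
    exact ⟨l, M, hkl, hlM,
      fun w hw i hi => h1 _ ⟨i, Nat.lt_succ_of_le hi⟩ w (hagree k M w hw),
      fun w hwR hw => h2 w hw hwR, fun w hwR hw => h3 _ w (hagree k M w hw) hwR⟩
  choose l H h using hmain
  exact ⟨z, O, l, H, h⟩

/-- Off a sparse set of free coordinates `c j`, with the others frozen to those of `z`, the map
`θ` is up to summable errors given blockwise, the `j`-th block depending on the coordinate `c j`
only. -/
theorem exists_blockwise_approximation [∀ n, DiscreteTopology (A n)] [∀ n, Nonempty (A n)] (hq : 0 < q)
    (hθ : ∀ n, Measurable fun x => θ x n)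
    (htail : ∀ x y, (∀ᶠ n in atTop, x n = y n) → EllRel Y q (θ x) (θ y)) :
    ∃ (z : ∀ n, A n) (c l : ℕ → ℕ) (K : ℝ), StrictMono c ∧ StrictMono l ∧
      ∀ w, (∀ n ∉ Set.range c, w n = z n) → ∀ j,
        ellSum q (Finset.Ico (l j) (l (j + 1))) (θ w) (θ (Function.update z (c j) (w (c j)))) ≤
          K * (1 / 2) ^ j := by
  obtain ⟨z, O, l, H, h⟩ := exists_generic_point hq hθ htail
  choose hkl hlH hO hT hS using h
  -- The free coordinates are `b (j + 1)`. Strictly between `b j` and `b (j + 1) = H (b j + 1)`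
  -- everything is frozen, which is the window that `H` requires for `k = b j + 1`.
  let b : ℕ → ℕ := fun j => Nat.rec 0 (fun _ n => H (n + 1)) j
  have hbs : ∀ j, b (j + 1) = H (b j + 1) := fun j => rfl
  have hb : StrictMono b := strictMono_nat_of_lt_succ fun j => by
    have := hkl (b j + 1); have := hlH (b j + 1); have := hbs j; omega
  have hjb : ∀ j, j ≤ b j := fun j => hb.le_apply
  have hK : ∀ w : ∀ n, A n, (∀ n ∉ Set.range fun j => b (j + 1), w n = z n) →
      ∀ j n, b j + 1 ≤ n → n < H (b j + 1) → w n = z n := by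
    intro w hw j n h1 h2
    refine hw n ?_
    rintro ⟨i, rfl⟩
    have h3 : j < i + 1 := hb.lt_iff_lt.1 h1
    have h4 : i + 1 < j + 1 := hb.lt_iff_lt.1 h2
    omega
  have hKO : ∀ w : ∀ n, A n, (∀ n ∉ Set.range fun j => b (j + 1), w n = z n) → w ∈ ⋂ i, O i :=
    fun w hw => Set.mem_iInter.2 fun i =>
      hO (b i + 1) w (hK w hw i) i ((hjb i).trans (Nat.le_succ _))
  refine ⟨z, fun j => b (j + 1), fun j => l (b j + 1), 2 ^ q * 2,
    fun i j hij => hb (Nat.succ_lt_succ hij), strictMono_nat_of_lt_succ fun j => ?_,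
    fun w hw j => ?_⟩
  · have := hlH (b j + 1); have := hkl (b (j + 1) + 1); have := hbs j; omega
  set v := Function.update z (b (j + 1)) (w (b (j + 1))) with hv
  have hvz : ∀ n, n ≠ b (j + 1) → v n = z n := fun n hn => Function.update_of_ne hn _ _
  have hvO : v ∈ ⋂ i, O i := hKO v fun n hn => hvz n fun h => hn ⟨j, h.symm⟩
  have hvT := hT (b j + 1) v hvO fun n hn => hvz n (by rw [hbs]; exact hn.ne)
  -- The intermediate point follows `w` up to `b (j + 1)` and `z` afterwards. It differs from `v`
  -- only below `b j + 1`, so `hT` controls the tail; it differs from `w` only beyond `b (j + 1)`,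
  -- so `hS` controls the initial part. The block lies in both ranges.
  have hx : overwrite (b j + 1) (fun i => w i) v =
      overwrite (b (j + 1) + 1) (fun i => w i) z := by
    funext n
    rcases lt_or_ge n (b j + 1) with h1 | h1
    · rw [overwrite_of_lt h1, overwrite_of_lt (h1.trans (Nat.succ_lt_succ (hb (Nat.lt_succ_self j))))]
    rw [overwrite_of_le h1]
    rcases lt_trichotomy n (b (j + 1)) with h2 | h2 | h2
    · rw [overwrite_of_lt (h2.trans (Nat.lt_succ_self _)), hvz n h2.ne, hK w hw j n h1 h2]
    · subst h2
      rw [overwrite_of_lt (Nat.lt_succ_self _), hv, Function.update_self]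
    · rw [overwrite_of_le h2, hvz n h2.ne']
  have h1 := hvT (fun i => w i) (fun i => v i) (l (b (j + 1) + 1))
  rw [overwrite_self, hx] at h1
  have h2 := hS (b (j + 1) + 1) w (hKO w hw) (hK w hw (j + 1))
  have h3 := (ellSum_mono (q := q) (s := Finset.Ico (l (b j + 1)) (l (b (j + 1) + 1)))
    (fun n hn => Finset.mem_range.2 (Finset.mem_Ico.1 hn).2) _ _).trans h2
  have hp : ∀ m, j ≤ m → (1 / 2 : ℝ) ^ m ≤ (1 / 2) ^ j := fun m hm =>
    pow_le_pow_of_le_one (by norm_num) (by norm_num) hm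
  have h4 := hp (b j + 1) ((hjb j).trans (Nat.le_succ _))
  have h5 := hp (b (j + 1) + 1) (by have := hjb (j + 1); omega)
  refine (ellSum_triangle hq.le _ _ (θ (overwrite (b (j + 1) + 1) (fun i => w i) z)) _).trans ?_
  rw [mul_assoc]
  exact mul_le_mul_of_nonneg_left (by linarith) (by positivity)

end Localization

/-! ### Block sums and finitely supported elements of `ℓ_q`. -/

theorem summable_iff_summable_sum_Ico {f : ℕ → ℝ} (hf : ∀ n, 0 ≤ f n) {l : ℕ → ℕ}
    (hl : StrictMono l) :
    Summable f ↔ Summable fun j => ∑ n ∈ Finset.Ico (l j) (l (j + 1)), f n := by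
  have hsum : ∀ J, ∑ j ∈ Finset.range J, ∑ n ∈ Finset.Ico (l j) (l (j + 1)), f n =
      ∑ n ∈ Finset.Ico (l 0) (l J), f n := by
    intro J
    induction J with
    | zero => simp
    | succ J ih =>
      rw [Finset.sum_range_succ, ih, Finset.sum_Ico_consecutive _ (hl.monotone (Nat.zero_le J))
        (hl.monotone (Nat.le_succ J))]
  constructor <;> intro h
  · refine summable_of_sum_range_le (fun j => Finset.sum_nonneg fun n _ => hf n)
      (c := ∑' n, f n) fun J => ?_
    rw [hsum]
    exact h.sum_le_tsum _ fun n _ => hf n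
  · refine summable_of_sum_range_le hf (c := ∑ n ∈ Finset.range (l 0), f n +
      ∑' j, ∑ n ∈ Finset.Ico (l j) (l (j + 1)), f n) fun N => ?_
    have h1 := h.sum_le_tsum (Finset.range N) fun j _ => Finset.sum_nonneg fun n _ => hf n
    rw [hsum] at h1
    calc ∑ n ∈ Finset.range N, f n ≤ ∑ n ∈ Finset.range (l N), f n :=
          Finset.sum_le_sum_of_subset_of_nonneg (Finset.range_mono hl.le_apply) fun n _ _ => hf n
      _ = ∑ n ∈ Finset.range (l 0), f n + ∑ n ∈ Finset.Ico (l 0) (l N), f n :=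
          (Finset.sum_range_add_sum_Ico _ (hl.monotone (Nat.zero_le N))).symm
      _ ≤ _ := by linarith

section EllSum

variable {Y : ℕ → Type*} [∀ n, PseudoMetricSpace (Y n)] {q : ℝ}

/-- Two quasi-triangle inequalities, with geometrically small errors at both ends. -/
theorem summable_ellSum_of_approx (hq : 0 ≤ q) {s : ℕ → Finset ℕ} {x x' y y' : ℕ → ∀ n, Y n}
    {K : ℝ} (hx : ∀ j, ellSum q (s j) (x j) (x' j) ≤ K * (1 / 2) ^ j)
    (hy : ∀ j, ellSum q (s j) (y j) (y' j) ≤ K * (1 / 2) ^ j)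
    (h : Summable fun j => ellSum q (s j) (x j) (y j)) :
    Summable fun j => ellSum q (s j) (x' j) (y' j) := by
  have hg : Summable fun j : ℕ => K * (1 / 2 : ℝ) ^ j :=
    (summable_geometric_of_lt_one (by norm_num) (by norm_num)).mul_left K
  refine Summable.of_nonneg_of_le (fun j => ellSum_nonneg _ _ _) (fun j => ?_)
    ((hg.add ((h.add hg).mul_left (2 ^ q))).mul_left (2 ^ q))
  have h0 : (0 : ℝ) ≤ 2 ^ q := by positivity
  refine (ellSum_triangle hq _ _ (x j) _).trans (mul_le_mul_of_nonneg_left (add_le_add ?_ ?_) h0)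
  · rw [ellSum_comm]; exact hx j
  · refine (ellSum_triangle hq _ _ (y j) _).trans (mul_le_mul_of_nonneg_left ?_ h0)
    exact add_le_add le_rfl (hy j)

variable {ystar : ∀ n, Y n}

/-- The element of `ℓ_q((Y_n), y*)` that agrees with `y` on the finite set `s` and with `y*`
elsewhere. -/
noncomputable def EllSpace.ofFinset [hq : Fact (1 ≤ q)] (ystar : ∀ n, Y n) (s : Finset ℕ)
    (y : ∀ n, Y n) : EllSpace Y q ystar :=
  ⟨fun n => if n ∈ s then y n else ystar n,
    summable_of_ne_finset_zero (s := s) fun n hn => by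
      simp [hn, Real.zero_rpow (zero_lt_one.trans_le hq.out).ne']⟩

theorem EllSpace.dist_ofFinset_rpow [hq : Fact (1 ≤ q)] (s : Finset ℕ) (x y : ∀ n, Y n) :
    dist (ofFinset (q := q) ystar s x) (ofFinset ystar s y) ^ q = ellSum q s x y := by
  have hq0 : q ≠ 0 := (zero_lt_one.trans_le hq.out).ne'
  change ((∑' n, dist (if n ∈ s then x n else ystar n) (if n ∈ s then y n else ystar n) ^ q) ^
    (1 / q)) ^ q = _
  rw [← Real.rpow_mul (tsum_nonneg fun n => by positivity), one_div_mul_cancel hq0,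
    Real.rpow_one, tsum_eq_sum (s := s)]
  · exact Finset.sum_congr rfl fun n hn => by rw [if_pos hn, if_pos hn]
  · intro n hn
    rw [if_neg hn, if_neg hn, dist_self, Real.zero_rpow hq0]

end EllSum

/-! ### From the Borel reduction to the embedding. -/

/-- A Borel reduction of `F(X; p)` yields maps into `ℓ_q((Y_n), y*)` that reduce coordinatewise
along a subsequence of the given finite sets. -/
theorem BorelReducible.exists_coordinatewiseReduces {X : Type*} [MetricSpace X]
    {Y : ℕ → Type*} [∀ n, PseudoMetricSpace (Y n)] [∀ n, TopologicalSpace.SeparableSpace (Y n)]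
    {p q : ℝ} (hp : 0 < p) [hq : Fact (1 ≤ q)] {F : ℕ → Finset X} (hF : ∀ n, (F n).Nonempty)
    (hred : BorelReducible (FRel F p) (EllRel Y q)) (ystar : ∀ n, Y n) :
    ∃ (c : ℕ → ℕ) (T : ℕ → X → EllSpace Y q ystar), StrictMono c ∧
      CoordinatewiseReduces (fun j => F (c j)) T p q := by
  classical
  obtain ⟨θ, hθm, hθ⟩ := hred
  have hq0 : 0 < q := zero_lt_one.trans_le hq.out
  have : ∀ n, Nonempty {u // u ∈ F n} := fun n => (hF n).to_subtype
  have : ∀ n, SecondCountableTopology (Y n) := fun n =>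
    UniformSpace.secondCountable_of_separable _
  let _ : MeasurableSpace (∀ n, {u // u ∈ F n}) := borel _
  have : BorelSpace (∀ n, {u // u ∈ F n}) := ⟨rfl⟩
  let _ : ∀ n, MeasurableSpace (Y n) := fun n => borel _
  have : ∀ n, BorelSpace (Y n) := fun n => ⟨rfl⟩
  have hθn : ∀ n, Measurable fun x => θ x n := fun n =>
    (continuous_apply n).borel_measurable.comp hθm
  obtain ⟨z, c, l, K, hc, hl, happrox⟩ := exists_blockwise_approximation hq0 hθn
    fun x y hxy => (hθ x y).1 <| by
      refine summable_of_hasFiniteSupport (Filter.eventually_cofinite.1 ?_)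
      rw [Nat.cofinite_eq_atTop]
      filter_upwards [hxy] with n hn
      rw [hn, dist_self, Real.zero_rpow hp.ne']
  -- The maps must be defined on all of `X`; the default `z n` outside `F n` plays no role in the
  -- reduction.
  let clip : ∀ n, X → {u // u ∈ F n} := fun n u => if h : u ∈ F n then ⟨u, h⟩ else z n
  have hclip : ∀ n u, u ∈ F n → (clip n u : X) = u := fun n u h => by simp [clip, h]
  let Φ : ℕ → X → ∀ n, Y n := fun j u => θ (Function.update z (c j) (clip (c j) u))
  let w : (ℕ → X) → ∀ n, {u // u ∈ F n} := fun x n =>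
    clip n (Function.extend c x (fun n => z n) n)
  have hwc : ∀ x j, w x (c j) = clip (c j) (x j) := fun x j => by
    simp only [w, hc.injective.extend_apply]
  have hwn : ∀ x, ∀ n ∉ Set.range c, w x n = z n := fun x n hn => by
    have : Function.extend c x (fun n => (z n : X)) n = z n :=
      Function.extend_apply' _ _ _ (by simpa using hn)
    simp only [w, this]
    exact Subtype.ext (hclip n _ (z n).2)
  let s : ℕ → Finset ℕ := fun j => Finset.Ico (l j) (l (j + 1))
  refine ⟨c, fun j u => EllSpace.ofFinset ystar (s j) (Φ j u), hc, fun x y hx hy => ?_⟩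
  have hb : ∀ x j, ellSum q (s j) (θ (w x)) (Φ j (x j)) ≤ K * (1 / 2) ^ j := fun x j => by
    simpa only [hwc] using happrox (w x) (hwn x) j
  have hb' : ∀ x j, ellSum q (s j) (Φ j (x j)) (θ (w x)) ≤ K * (1 / 2) ^ j := fun x j => by
    rw [ellSum_comm]; exact hb x j
  simp only [EllSpace.dist_ofFinset_rpow]
  calc (Summable fun j => dist (x j) (y j) ^ p)
      ↔ FRel F p (w x) (w y) := by
        rw [FRel, EllRel, ← hc.injective.summable_iff (f := fun n => dist (w x n) (w y n) ^ p)]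
        · simp only [Function.comp_def, hwc, Subtype.dist_eq, hclip _ _ (hx _), hclip _ _ (hy _)]
        · intro n hn
          rw [hwn x n hn, hwn y n hn, dist_self, Real.zero_rpow hp.ne']
    _ ↔ EllRel Y q (θ (w x)) (θ (w y)) := hθ _ _
    _ ↔ Summable fun j => ellSum q (s j) (θ (w x)) (θ (w y)) :=
        summable_iff_summable_sum_Ico (fun n => by positivity) hl
    _ ↔ Summable fun j => ellSum q (s j) (Φ j (x j)) (Φ j (y j)) :=
        ⟨summable_ellSum_of_approx hq0.le (hb x) (hb y),
          summable_ellSum_of_approx hq0.le (hb' x) (hb' y)⟩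

theorem IsFiniteExhaustion.comp {X : Type*} [MetricSpace X] {F : ℕ → Finset X}
    (hF : IsFiniteExhaustion F) {c : ℕ → ℕ} (hc : StrictMono c) :
    IsFiniteExhaustion fun j => F (c j) where
  nonempty j := hF.nonempty _
  mono := hF.mono.comp hc.monotone
  dense := hF.dense.mono <| Set.iUnion_subset fun n =>
    Set.subset_iUnion_of_subset n (by exact_mod_cast hF.mono hc.le_apply)

theorem mainTheorem4 {X : Type*} [MetricSpace X] [CompleteSpace X]
    [TopologicalSpace.SeparableSpace X]
    {Y : ℕ → Type*} [∀ n, MetricSpace (Y n)] [∀ n, CompleteSpace (Y n)]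
    [∀ n, TopologicalSpace.SeparableSpace (Y n)]
    (p q : ℝ) (hp : 1 ≤ p) [Fact (1 ≤ q)] (C : ℝ) (hC : 0 < C) (hlink : Link X C)
    (F : ℕ → Finset X) (hF : IsFiniteExhaustion F)
    (hred : BorelReducible (FRel F p) (EllRel Y q)) (ystar : ∀ n, Y n) :
    FinitelyHolderEmbeds X (EllSpace Y q ystar) C (p / q) := by
  obtain ⟨c, T, hc, hT⟩ :=
    hred.exists_coordinatewiseReduces (zero_lt_one.trans_le hp) hF.nonempty ystar
  exact hT.finitelyHolderEmbeds (hF.comp hc) hp Fact.out hC hlink
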